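/- Let $\mathbf{G}$ be a locally compact, second countable, Hausdorff topological group with left Haar measure $\lambda$. Let $\mathbf{X}$ and $\mathbf{Y}$ be topological spaces whose Borel $\sigma$-algebras are standard Borel, and let $\mathbf{G}$ act continuously on each of them. Assume that the action on $\mathbf{X}$ is proper: there is a strictly positive, finite-valued, measurable $h$ on $\mathbf{X}$ with $\int_{\mathbf{G}} h(gx)\,\lambda(dg)<\infty$ for every $x\in\mathbf{X}$. Let $\rho\colon\mathbf{X}\to\mathbf{X}$ be an orbit selector (each $\rho(x)$ lies on the orbit of $x$, and $\rho(gx)=\rho(x)$ for all $g,x$). Let $P_{\tilde\Gamma|X}$ be a measurable inversion kernel for $\rho$, that is, a Markov kernel from $\mathbf{X}$ to $\mathbf{G}$ such that $P_{\tilde\Gamma|X}(gB\mid gx)=P_{\tilde\Gamma|X}(B\mid x)$ for all $g\in\mathbf{G}$, $x\in\mathbf{X}$ and Borel $B\subseteq\mathbf{G}$, and such that for every $x$ one has $\gamma\rho(x)=x$ for $P_{\tilde\Gamma|X}(\cdot\mid x)$-almost every $\gamma$. Let $M$ be a measurable maximal invariant on $\mathbf{X}$ with values in a standard Borel space, so that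 $M(x)=M(x')$ if and only if $gx=x'$ for some $g\in\mathbf{G}$. Let $X$, $Y$, $\tilde\Gamma$ be random elements of $\mathbf{X}$, $\mathbf{Y}$, $\mathbf{G}$, defined on a common standard Borel probability space, where $\tilde\Gamma\sim P_{\tilde\Gamma|X}(\cdot\mid X)$ is sampled given $X$ without regard to $Y$; that is, the conditional distribution of $\tilde\Gamma$ given $(X,Y)$ is $P_{\tilde\Gamma|X}(\cdot\mid X)$. The law of $(X,Y)$ is otherwise arbitrary. Say that $P_{Y|X}$ is $\mathbf{G}$-equivariant if the conditional distribution of $Y$ given $X$ has a version, a Markov kernel $Q$ from $\mathbf{X}$ to $\mathbf{Y}$, with $Q(gB\mid gx)=Q(B\mid x)$ for all $g\in\mathbf{G}$, $x\in\mathbf{X}$ and measurable $B\subseteq\mathbf{Y}$. Then: 1. $P_{Y|X}$ is $\mathbf{G}$-equivariant if and only if $(\tilde\Gamma,X)$ and $\tilde\Gamma^{-1}Y$ are conditionally independent given $M(X)$. 2. If there is a measurable representative inversion for $\rho$, that is, a measurable $\tau\colon\mathbf{X}\to\mathbf{G}$ with $\tau(gx)=g\tau(x)$ and $\tau(x)\rho(x)=x$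 for all $g\in\mathbf{G}$ and $x\in\mathbf{X}$, then $P_{Y|X}$ is $\mathbf{G}$-equivariant if and only if $X$ and $\tau(X)^{-1}Y$ are conditionally independent given $M(X)$. 3. If the action of $\mathbf{G}$ on $\mathbf{Y}$ is trivial, then $P_{Y|X}$ is $\mathbf{G}$-equivariant if and only if $X$ and $Y$ are conditionally independent given $M(X)$. -/

import Mathlib

open MeasureTheory ProbabilityTheory
open scoped Pointwise NNReal ENNReal

namespace CondSymmetry

/-- The action of `G` on `𝕏` is proper: there is a strictly positive measurable function `h` on `𝕏`
with `∫ h (g x) λ(dg) < ∞` for every `x`, where `λ` is left Haar measure on `G`. -/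
def IsProperAction (G 𝕏 : Type*) [Group G] [TopologicalSpace G] [IsTopologicalGroup G]
    [LocallyCompactSpace G] [MeasurableSpace G] [BorelSpace G] [MeasurableSpace 𝕏]
    [MulAction G 𝕏] : Prop :=
  ∃ h : 𝕏 → ℝ≥0, Measurable h ∧ (∀ x, 0 < h x) ∧
    ∀ x, ∫⁻ g : G, (h (g • x) : ℝ≥0∞) ∂(Measure.haar : Measure G) < ∞

/-- An orbit selector picks one and the same point `ρ x` on the orbit of `x` for all points
of that orbit. -/
structure IsOrbitSelector (G : Type*) {𝕏 : Type*} [Group G] [MulAction G 𝕏]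
    (ρ : 𝕏 → 𝕏) : Prop where
  mem_orbit : ∀ x, ρ x ∈ MulAction.orbit G x
  invariant : ∀ (g : G) (x : 𝕏), ρ (g • x) = ρ x

/-- A maximal invariant takes the same value at two points if and only if they lie on the
same orbit. -/
def IsMaximalInvariant (G : Type*) {𝕏 𝕄 : Type*} [Group G] [MulAction G 𝕏]
    (M : 𝕏 → 𝕄) : Prop :=
  ∀ x x' : 𝕏, M x = M x' ↔ ∃ g : G, g • x = x'

/-- A kernel `Q` from `𝕏` to `𝕐` is `G`-equivariant: `Q(B | x) = Q(gB | gx)` for all `x`, `g` and all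
measurable `B`. -/
def IsEquivariantKernel (G : Type*) {𝕏 𝕐 : Type*} [Group G]
    [MeasurableSpace 𝕏] [MeasurableSpace 𝕐] [MulAction G 𝕏] [MulAction G 𝕐]
    (Q : Kernel 𝕏 𝕐) : Prop :=
  ∀ (g : G) (x : 𝕏) (B : Set 𝕐), MeasurableSet B → Q (g • x) (g • B) = Q x B

/-- An inversion kernel for the orbit selector `ρ`: a Markov kernel from `𝕏` to `G`, equivariant for
the left multiplication of `G` on itself, such that `γ ρ(x) = x` almost surely when `γ` is drawn
from `κ(· | x)`. -/
structure IsInversionKernel {G 𝕏 : Type*} [Group G] [MeasurableSpace G]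
    [MeasurableSpace 𝕏] [MulAction G 𝕏] (ρ : 𝕏 → 𝕏) (κ : Kernel 𝕏 G) : Prop where
  isMarkov : IsMarkovKernel κ
  equivariant : IsEquivariantKernel G κ
  smul_eq : ∀ x, ∀ᵐ γ ∂(κ x), γ • ρ x = x

/-- A representative inversion for the orbit selector `ρ`: an equivariant map `τ` from `𝕏` to `G`
with `τ(x) ρ(x) = x`. -/
structure IsRepresentativeInversion {G 𝕏 : Type*} [Group G] [MulAction G 𝕏]
    (ρ : 𝕏 → 𝕏) (τ : 𝕏 → G) : Prop where
  equivariant : ∀ (g : G) (x : 𝕏), τ (g • x) = g * τ x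
  smul_eq : ∀ x, τ x • ρ x = x

/-- The conditional distribution of `Y` given `X` is `G`-equivariant: it has a version, that is, a
Markov kernel `Q` with `law (X, Y) = law X ⊗ Q`, which is a `G`-equivariant kernel. -/
def IsEquivariantCondDistrib (G : Type*) {𝕏 𝕐 Ω : Type*} [Group G]
    [MeasurableSpace 𝕏] [MeasurableSpace 𝕐] [MulAction G 𝕏] [MulAction G 𝕐]
    [MeasurableSpace Ω] (P : Measure Ω) (X : Ω → 𝕏) (Y : Ω → 𝕐) : Prop :=
  ∃ Q : Kernel 𝕏 𝕐, IsMarkovKernel Q ∧ HasCondDistrib Y X Q P ∧ IsEquivariantKernel G Q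

/-- `γ` is drawn from `κ(· | X)`, with no further dependence on `Y`: the conditional distribution of
`γ` given `(X, Y)` is `κ(· | X)`. -/
def IsSampledFrom {G 𝕏 𝕐 Ω : Type*} [MeasurableSpace G] [MeasurableSpace 𝕏] [MeasurableSpace 𝕐]
    [MeasurableSpace Ω] (P : Measure Ω) (X : Ω → 𝕏) (Y : Ω → 𝕐) (γ : Ω → G)
    (κ : Kernel 𝕏 G) : Prop :=
  HasCondDistrib γ (fun ω => (X ω, Y ω)) (Kernel.prodMkRight 𝕐 κ) P

end CondSymmetry

/-!
The conditional distribution of `Y` given `X` is equivariant exactly when the orbit-normalised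
variable `γ⁻¹ Y` has, given `(γ, X)`, a law that depends on the orbit of `X` alone.

The probabilistic input is that, for a map `m`, conditional independence of `Z` and `W` given `m(Z)`
means that the conditional distribution of `W` given `Z` can be taken to depend on `z` through `m(z)`
only (`condIndepFun_of_hasCondDistrib`, `hasCondDistrib_of_condIndepFun`). It is applied to
`Z = (X, γ)`, `m(x, g) = M(x)` and `W = γ⁻¹ Y`.

If `Q` is an equivariant version of the conditional distribution of `Y` given `X`, then, since `γ` is
drawn without regard to `Y`, the law of `γ⁻¹ Y` given `X = x` and `γ` is `γ⁻¹ Q(x) = Q(γ⁻¹ x)`, and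
this is `Q(ρ x)` almost surely. The map `x ↦ Q(ρ x)` is measurable although `ρ` need not be: it is
the average of `Q(γ⁻¹ x)` over the inversion kernel
(`IsInversionKernel.exists_kernel_eq_orbitSelector`). Being constant on orbits it is measurable for
the σ-algebra generated by `M`, by separation of analytic sets (`measurable_comap_of_forall_eq`).

Conversely, let `R(m)` be the conditional law of `γ⁻¹ Y` given `M(X) = m`. Conditional independence
makes the law of `g w`, with `g` drawn from `κ(x)` and `w` independently from `R(M(x))`, a version of
the conditional distribution of `Y = γ (γ⁻¹ Y)` given `X = x`. It is equivariant at every point,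
because `κ` is and `R ∘ M` is constant on orbits (`IsEquivariantKernel.map_smul_compProd`).

A representative inversion `τ` is the inversion kernel whose value at `x` is the point mass at
`τ x`; the variables `(τ(X), X)` and `X` carry the same information. For a trivial action on `𝕐`,
`γ⁻¹ Y = Y`, and every kernel that is a function of `M` is equivariant.
-/

namespace CondSymmetry

/-! ### Conditional expectations that are measurable for a smaller σ-algebra -/

section CondExp

/-- If the conditional expectation of `g` given `m₂` is measurable for the smaller `m₁`, then `g` is
conditionally uncorrelated, given `m₁`, with everything measurable for `m₂`. -/
lemma condExp_mul_ae_eq_of_condExp_ae_eq {Ω : Type*} {m₁ m₂ mΩ : MeasurableSpace Ω}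
    {P : Measure Ω} [IsFiniteMeasure P] (h₁₂ : m₁ ≤ m₂) (h₂ : m₂ ≤ mΩ) {f g k : Ω → ℝ}
    (hf : StronglyMeasurable[m₂] f) (hk : StronglyMeasurable[m₁] k) (hfi : Integrable f P)
    (hgi : Integrable g P) (hfgi : Integrable (f * g) P) (hgk : P[g | m₂] =ᵐ[P] k) :
    P[f * g | m₁] =ᵐ[P] P[f | m₁] * P[g | m₁] := by
  have hfk : P[f * g | m₂] =ᵐ[P] f * k :=
    (condExp_mul_of_stronglyMeasurable_left hf hfgi hgi).trans
      (Filter.EventuallyEq.rfl.mul hgk)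
  have hki : Integrable k P := (integrable_congr hgk).1 integrable_condExp
  have hfki : Integrable (f * k) P := (integrable_congr hfk).1 integrable_condExp
  have hg : P[g | m₁] =ᵐ[P] k :=
    (condExp_condExp_of_le h₁₂ h₂).symm.trans <| (condExp_congr_ae hgk).trans <|
      (condExp_of_stronglyMeasurable (h₁₂.trans h₂) hk hki).eventuallyEq
  exact (condExp_condExp_of_le h₁₂ h₂).symm.trans <| (condExp_congr_ae hfk).trans <|
    (condExp_mul_of_stronglyMeasurable_right hk hfki hfi).trans
      (Filter.EventuallyEq.rfl.mul hg.symm)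

lemma indicator_inter_one_eq_mul {Ω : Type*} (s t : Set Ω) :
    (s ∩ t).indicator (fun _ => (1 : ℝ)) = s.indicator (fun _ => 1) * t.indicator fun _ => 1 := by
  ext ω
  by_cases hs : ω ∈ s <;> by_cases ht : ω ∈ t <;> simp [hs, ht]

end CondExp

/-! ### Conditional distributions and conditional independence -/

section CondDistrib

variable {Ω 𝓧 𝓨 𝓩 : Type*} [MeasurableSpace Ω] [MeasurableSpace 𝓧] [MeasurableSpace 𝓨]
  [MeasurableSpace 𝓩] {P : Measure Ω} {X : Ω → 𝓧} {Y : Ω → 𝓨} {Z : Ω → 𝓩}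

lemma hasCondDistrib_prodMk {κ : Kernel 𝓧 𝓨} {η : Kernel (𝓧 × 𝓨) 𝓩}
    (hY : HasCondDistrib Y X κ P) (hZ : HasCondDistrib Z (fun ω => (X ω, Y ω)) η P) :
    HasCondDistrib (fun ω => (Y ω, Z ω)) X (κ ⊗ₖ η) P where
  aemeasurable := by
    have hZ' := hZ.aemeasurable_snd
    have hX := hY.aemeasurable_fst
    have hY' := hY.aemeasurable_snd
    fun_prop
  map_eq := by
    have hX := hY.aemeasurable_fst
    have hY' := hY.aemeasurable_snd
    have hZ' := hZ.aemeasurable_snd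
    rw [← Measure.compProd_assoc', ← hY.map_eq, ← hZ.map_eq,
      AEMeasurable.map_map_of_aemeasurable (by fun_prop) (by fun_prop)]
    rfl

/-- If `Z` is drawn given `(X, Y)` from a kernel that only looks at `X`, then conversely `Z` carries
no information on `Y` beyond that of `X`. -/
lemma hasCondDistrib_prodMkRight_symm [SFinite P] {κ : Kernel 𝓧 𝓨} {η : Kernel 𝓧 𝓩}
    [IsMarkovKernel κ] [IsMarkovKernel η]
    (hY : HasCondDistrib Y X κ P)
    (hZ : HasCondDistrib Z (fun ω => (X ω, Y ω)) (Kernel.prodMkRight 𝓨 η) P) :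
    HasCondDistrib Y (fun ω => (X ω, Z ω)) (Kernel.prodMkRight 𝓩 κ) P := by
  refine HasCondDistrib.of_compProd (κ := η) ?_
  have h := (hasCondDistrib_prodMk hY hZ).comp_left measurable_swap
  have hswap : (κ ⊗ₖ Kernel.prodMkRight 𝓨 η).map Prod.swap = η ⊗ₖ Kernel.prodMkRight 𝓩 κ := by
    ext1 x
    refine Measure.ext_prod fun {s t} hs ht => ?_
    rw [Kernel.map_apply' _ measurable_swap _ (hs.prod ht), Set.preimage_swap_prod,
      Kernel.compProd_apply_prod ht hs, Kernel.compProd_apply_prod hs ht]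
    simp [mul_comm]
  rwa [hswap] at h

/-- The conditional distribution of `f (Z, Y)` given `Z` is obtained by pushing the conditional
distribution of `Y` given `Z = z` forward along `f (z, ·)`. -/
lemma hasCondDistrib_apply_prodMk [SFinite P] {𝓦 : Type*} [MeasurableSpace 𝓦]
    {κ : Kernel 𝓩 𝓨} {η : Kernel 𝓩 𝓦} [IsSFiniteKernel κ] [IsSFiniteKernel η]
    (h : HasCondDistrib Y Z κ P) {f : 𝓩 × 𝓨 → 𝓦} (hf : Measurable f)
    (hη : ∀ z, η z = (κ z).map fun y => f (z, y)) :
    HasCondDistrib (fun ω => f (Z ω, Y ω)) Z η P where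
  aemeasurable := by
    have hZ := h.aemeasurable_fst
    have hY := h.aemeasurable_snd
    fun_prop
  map_eq := by
    have hg : Measurable fun p : 𝓩 × 𝓨 => (p.1, f p) := by fun_prop
    have e : P.map (fun ω => (Z ω, f (Z ω, Y ω)))
        = (P.map fun ω => (Z ω, Y ω)).map fun p => (p.1, f p) := by
      rw [AEMeasurable.map_map_of_aemeasurable (by fun_prop) h.aemeasurable]
      rfl
    rw [e, h.map_eq]
    ext s hs
    rw [Measure.map_apply hg hs, Measure.compProd_apply (hg hs), Measure.compProd_apply hs]
    refine lintegral_congr fun z => ?_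
    rw [hη, Measure.map_apply (by fun_prop) (measurable_prodMk_left hs)]
    rfl

variable {𝓜 : Type*} [MeasurableSpace 𝓜]

/-- The conditional expectation of `1_B(Y)` given `Z` is `κ(Z, B)` for every version `κ` of the
conditional distribution. -/
lemma condExp_ae_eq_of_hasCondDistrib [StandardBorelSpace 𝓨] [IsFiniteMeasure P]
    {κ : Kernel 𝓩 𝓨} [IsMarkovKernel κ] (hZ : Measurable Z) (hY : Measurable Y)
    (h : HasCondDistrib Y Z κ P) {B : Set 𝓨} (hB : MeasurableSet B) :
    P⟦Y ⁻¹' B | MeasurableSpace.comap Z inferInstance⟧ =ᵐ[P] fun ω => (κ (Z ω)).real B := by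
  rcases isEmpty_or_nonempty Ω with hΩ | ⟨⟨ω₀⟩⟩
  · exact Filter.Eventually.of_forall fun ω => (hΩ.false ω).elim
  have : Nonempty 𝓨 := ⟨Y ω₀⟩
  have h1 := ae_of_ae_map hZ.aemeasurable
    (condDistrib_ae_eq_of_measure_eq_compProd Z hY.aemeasurable h.map_eq)
  filter_upwards [condDistrib_ae_eq_condExp (μ := P) hZ hY hB, h1] with ω h2 h3
  rw [← h2, h3]

variable [StandardBorelSpace Ω] [IsProbabilityMeasure P] [StandardBorelSpace 𝓨]

/-- If the conditional distribution of `Y` given `Z` depends on `Z` only through `m(Z)`, then `Z`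
and `Y` are conditionally independent given `m(Z)`. -/
lemma condIndepFun_of_hasCondDistrib {κ : Kernel 𝓩 𝓨} [IsMarkovKernel κ]
    (hZ : Measurable Z) (hY : Measurable Y) (h : HasCondDistrib Y Z κ P)
    {m : 𝓩 → 𝓜} (hm : Measurable m)
    (hκ : ∀ B, MeasurableSet B →
      Measurable[MeasurableSpace.comap m inferInstance] fun z => κ z B) :
    Z ⟂ᵢ[m ∘ Z, hm.comp hZ; P] Y := by
  rw [condIndepFun_iff_condExp_inter_preimage_eq_mul hZ hY]
  intro A B hA hB
  rw [indicator_inter_one_eq_mul]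
  refine condExp_mul_ae_eq_of_condExp_ae_eq ?_ hZ.comap_le (k := fun ω => (κ (Z ω)).real B)
    (stronglyMeasurable_const.indicator ⟨A, hA, rfl⟩) ?_
    ((integrable_const 1).indicator (hZ hA)) ((integrable_const 1).indicator (hY hB)) ?_
    (condExp_ae_eq_of_hasCondDistrib hZ hY h hB)
  · rw [← MeasurableSpace.comap_comp]
    exact MeasurableSpace.comap_mono hm.comap_le
  · refine Measurable.stronglyMeasurable ?_
    rw [← MeasurableSpace.comap_comp]
    exact ((hκ B hB).ennreal_toReal).comp (comap_measurable Z)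
  · rw [← indicator_inter_one_eq_mul]
    exact (integrable_const 1).indicator ((hZ hA).inter (hY hB))

/-- If `Z` and `Y` are conditionally independent given `m(Z)`, then the conditional distribution of
`Y` given `m(Z)` is also its conditional distribution given `Z`. -/
lemma hasCondDistrib_of_condIndepFun [Nonempty 𝓨] (hZ : Measurable Z) (hY : Measurable Y)
    {m : 𝓩 → 𝓜} (hm : Measurable m) (h : Z ⟂ᵢ[m ∘ Z, hm.comp hZ; P] Y) :
    HasCondDistrib Y Z ((condDistrib Y (m ∘ Z) P).comap m hm) P where
  aemeasurable := by fun_prop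
  map_eq := by
    set R := condDistrib Y (m ∘ Z) P
    refine Measure.ext_prod fun {A B} hA hB => ?_
    rw [condIndepFun_iff_condExp_inter_preimage_eq_mul hZ hY] at h
    have hle := (hm.comp hZ).comap_le
    have h' := h A B hA hB
    have hR := condDistrib_ae_eq_condExp (μ := P) (hm.comp hZ) hY hB
    have hk : StronglyMeasurable[MeasurableSpace.comap (m ∘ Z) inferInstance]
        fun ω => (R (m (Z ω))).real B :=
      (measurable_condDistrib hB).ennreal_toReal.stronglyMeasurable
    have hRi : Integrable (fun ω => (R (m (Z ω))).real B) P :=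
      (integrable_congr hR.symm).1 integrable_condExp
    have hfi : Integrable ((Z ⁻¹' A).indicator fun _ => (1 : ℝ)) P :=
      (integrable_const 1).indicator (hZ hA)
    have hfk : (Z ⁻¹' A).indicator (fun _ => (1 : ℝ)) * (fun ω => (R (m (Z ω))).real B)
        = (Z ⁻¹' A).indicator fun ω => (R (m (Z ω))).real B := by
      ext ω
      by_cases hω : ω ∈ Z ⁻¹' A <;> simp [hω]
    have hfki : Integrable ((Z ⁻¹' A).indicator (fun _ => (1 : ℝ)) *
        (fun ω => (R (m (Z ω))).real B)) P := by
      rw [hfk]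
      exact hRi.indicator (hZ hA)
    have key : P.real (Z ⁻¹' A ∩ Y ⁻¹' B) = ∫ ω in Z ⁻¹' A, (R (m (Z ω))).real B ∂P := by
      calc P.real (Z ⁻¹' A ∩ Y ⁻¹' B)
          = ∫ ω, (P⟦Z ⁻¹' A ∩ Y ⁻¹' B | MeasurableSpace.comap (m ∘ Z) inferInstance⟧) ω ∂P := by
            rw [integral_condExp hle, integral_indicator_const _ ((hZ hA).inter (hY hB))]
            simp
        _ = ∫ ω, condExp (MeasurableSpace.comap (m ∘ Z) inferInstance) P
              ((Z ⁻¹' A).indicator (fun _ => (1 : ℝ)) * fun ω => (R (m (Z ω))).real B) ω ∂P := by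
            refine integral_congr_ae ?_
            have h1 := condExp_mul_of_stronglyMeasurable_right hk hfki hfi
            filter_upwards [h', hR, h1] with ω h2 h3 h4
            rw [h2, h4, Pi.mul_apply, ← h3]
            rfl
        _ = ∫ ω in Z ⁻¹' A, (R (m (Z ω))).real B ∂P := by
            rw [integral_condExp hle, hfk, integral_indicator (hZ hA)]
    rw [Measure.map_apply (by fun_prop) (hA.prod hB), Measure.compProd_apply_prod hA hB,
      setLIntegral_map hA (Kernel.measurable_coe _ hB) hZ, Set.mk_preimage_prod]
    rw [← ENNReal.toReal_eq_toReal_iff' (measure_ne_top _ _) ?_]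
    · rw [← measureReal_def, key, ← integral_toReal]
      · rfl
      · exact ((Kernel.measurable_coe _ hB).comp hZ).aemeasurable
      · exact Filter.Eventually.of_forall fun ω => measure_lt_top _ _
    · refine ((setLIntegral_mono (measurable_const (a := 1)) fun ω _ => prob_le_one).trans_lt ?_).ne
      simp

end CondDistrib

/-! ### Functions constant on the fibres of a measurable map -/

section Invariant

/-- A measurable function on a standard Borel space that is constant on the fibres of a measurable
map `M` is measurable for the σ-algebra generated by `M`, with no measurable section of `M` needed:
a measurable union of fibres has a measurable image in the range of `M`, by separation of analytic
sets. -/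
lemma measurable_comap_of_forall_eq {𝓧 𝓜 𝓡 : Type*} [MeasurableSpace 𝓧] [StandardBorelSpace 𝓧]
    [MeasurableSpace 𝓜] [MeasurableSpace.CountablySeparated 𝓜] [MeasurableSpace 𝓡]
    {M : 𝓧 → 𝓜} (hM : Measurable M) {f : 𝓧 → 𝓡} (hf : Measurable f)
    (h : ∀ x x', M x = M x' → f x = f x') :
    Measurable[MeasurableSpace.comap M inferInstance] f := by
  intro t ht
  have hsat : M ⁻¹' (M '' (f ⁻¹' t)) = f ⁻¹' t := by
    refine Set.Subset.antisymm ?_ (Set.subset_preimage_image _ _)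
    rintro x ⟨x', hx', hxx'⟩
    rwa [Set.mem_preimage, ← h x' x hxx']
  have : MeasurableSpace.CountablySeparated (Set.range M) :=
    MeasurableSpace.Subtype.countablySeparated
  obtain ⟨C, hC, hCe⟩ := hM.measurableSet_preimage_iff_preimage_val.1 (hsat ▸ hf ht)
  refine ⟨C, hC, ?_⟩
  rw [← hsat]
  ext x
  exact Set.ext_iff.1 hCe ⟨M x, x, rfl⟩

end Invariant

/-! ### Equivariant kernels and inversion kernels -/

section Action

variable {G : Type*} [Group G] [MeasurableSpace G]
  {𝕏 : Type*} [MeasurableSpace 𝕏] [MulAction G 𝕏]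
  {𝕐 : Type*} [MeasurableSpace 𝕐]
  {ρ : 𝕏 → 𝕏} {κ : Kernel 𝕏 G}

lemma IsEquivariantKernel.map_smul {G 𝕏 𝕐 : Type*} [Group G] [MeasurableSpace 𝕏]
    [MeasurableSpace 𝕐] [MulAction G 𝕏] [MulAction G 𝕐] [MeasurableConstSMul G 𝕐] {Q : Kernel 𝕏 𝕐}
    (hQ : IsEquivariantKernel G Q) (g : G) (x : 𝕏) : (Q x).map (g • ·) = Q (g • x) := by
  ext B hB
  rw [Measure.map_apply (measurable_const_smul g) hB, Set.preimage_smul,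
    ← hQ g x _ (hB.const_smul g⁻¹), smul_inv_smul]

/-- Averaging a Markov kernel `Q` over `γ⁻¹ x`, with `γ` drawn from an inversion kernel, gives
`Q (ρ x)`. This makes `x ↦ Q (ρ x)` a kernel even where `ρ` itself is not measurable. -/
lemma IsInversionKernel.exists_kernel_eq_orbitSelector
    [MeasurableInv G] [MeasurableSMul₂ G 𝕏] (hκ : IsInversionKernel ρ κ)
    (Q : Kernel 𝕏 𝕐) [IsMarkovKernel Q] :
    ∃ T : Kernel 𝕏 𝕐, ∀ x, T x = Q (ρ x) := by
  have := hκ.isMarkov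
  have hm : Measurable fun p : 𝕏 × G => p.2⁻¹ • p.1 := measurable_snd.inv.smul measurable_fst
  refine ⟨(κ ⊗ₖ Q.comap _ hm).snd, fun x => ?_⟩
  ext B hB
  rw [Kernel.snd_apply' _ _ hB, Kernel.compProd_apply (measurable_snd hB)]
  calc ∫⁻ γ, Q (γ⁻¹ • x) B ∂κ x = ∫⁻ _, Q (ρ x) B ∂κ x := by
        refine lintegral_congr_ae ?_
        filter_upwards [hκ.smul_eq x] with γ hγ
        rw [← eq_inv_smul_iff.2 hγ]
    _ = Q (ρ x) B := by simp

/-- If `γ ∈ G` is drawn from an equivariant kernel `κ` and `w` independently from a kernel that only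
depends on the orbit of `x`, then the law of `γ w` is equivariant in `x`. -/
lemma IsEquivariantKernel.map_smul_compProd [MulAction G 𝕐] [MeasurableMul G]
    [MeasurableSMul₂ G 𝕐] (hκ : IsEquivariantKernel G κ) [IsMarkovKernel κ]
    {R : Kernel 𝕏 𝕐} [IsMarkovKernel R] (hR : ∀ (g : G) x, R (g • x) = R x) :
    IsEquivariantKernel G ((κ ⊗ₖ Kernel.prodMkRight G R).map fun p => p.1 • p.2) := by
  have hs : Measurable fun p : G × 𝕐 => p.1 • p.2 := by fun_prop
  intro g x B hB
  have hgB : MeasurableSet (g • B) := hB.const_smul g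
  rw [Kernel.map_apply' _ hs _ hgB, Kernel.map_apply' _ hs _ hB,
    Kernel.compProd_apply (hs hgB), Kernel.compProd_apply (hs hB), ← hκ.map_smul g x,
    lintegral_map (Kernel.measurable_kernel_prodMk_left' (hs hgB) _)
      (measurable_const_smul g)]
  refine lintegral_congr fun γ => ?_
  rw [Kernel.prodMkRight_apply, Kernel.prodMkRight_apply, hR]
  congr 1
  ext y
  simp [mul_smul]

/-- A measurable representative inversion `τ` is the special case of an inversion kernel that is
the point mass at `τ x`. -/
lemma IsRepresentativeInversion.isInversionKernel [MeasurableSingletonClass G]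
    [MeasurableMul G] {τ : 𝕏 → G}
    (h : IsRepresentativeInversion ρ τ) (hτ : Measurable τ) :
    IsInversionKernel ρ (Kernel.deterministic τ hτ) where
  isMarkov := inferInstance
  equivariant g x B hB := by
    rw [Kernel.deterministic_apply' _ _ (hB.const_smul g),
      Kernel.deterministic_apply' _ _ hB, h.equivariant]
    have hmem : g * τ x ∈ g • B ↔ τ x ∈ B := Set.smul_mem_smul_set_iff (a := g)
    by_cases hx : τ x ∈ B <;> simp [hmem, hx]
  smul_eq x := by
    rw [Kernel.deterministic_apply, ae_dirac_eq]
    exact h.smul_eq x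

lemma isSampledFrom_deterministic {G 𝕏 𝕐 Ω : Type*} [MeasurableSpace G] [MeasurableSpace 𝕏]
    [MeasurableSpace 𝕐] [MeasurableSpace Ω] {P : Measure Ω} [SFinite P] {X : Ω → 𝕏} {Y : Ω → 𝕐}
    {τ : 𝕏 → G} (hτ : Measurable τ)
    (hX : Measurable X) (hY : Measurable Y) :
    IsSampledFrom P X Y (τ ∘ X) (Kernel.deterministic τ hτ) where
  aemeasurable := by fun_prop
  map_eq := by
    have : Kernel.prodMkRight 𝕐 (Kernel.deterministic τ hτ)
        = Kernel.deterministic (fun p : 𝕏 × 𝕐 => τ p.1) (hτ.comp measurable_fst) := rfl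
    rw [this, Measure.compProd_deterministic, Measure.map_map (by fun_prop) (by fun_prop)]
    rfl

end Action

/-! ### Equivariance of a conditional distribution and conditional independence -/

section EquivariantCondDistrib

variable {G : Type*} [Group G] [MeasurableSpace G] [MeasurableInv G]
  {𝕏 : Type*} [MeasurableSpace 𝕏] [MulAction G 𝕏]
  {𝕐 : Type*} [MeasurableSpace 𝕐] [StandardBorelSpace 𝕐] [MulAction G 𝕐] [MeasurableSMul₂ G 𝕐]
  {𝕄 : Type*} [MeasurableSpace 𝕄]
  {Ω : Type*} [MeasurableSpace Ω] [StandardBorelSpace Ω] {P : Measure Ω} [IsProbabilityMeasure P]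
  {ρ : 𝕏 → 𝕏} {κ : Kernel 𝕏 G} {M : 𝕏 → 𝕄} {X : Ω → 𝕏} {Y : Ω → 𝕐} {γ : Ω → G}

/-- Given `X = x` and `γ`, the law of `γ⁻¹ Y` is `Q (γ⁻¹ x) = Q (ρ x)`, which is a function of the
orbit of `x` alone. -/
lemma IsEquivariantCondDistrib.condIndepFun [StandardBorelSpace 𝕏]
    [MeasurableSMul₂ G 𝕏] [MeasurableSpace.CountablySeparated 𝕄]
    (hρ : IsOrbitSelector G ρ) (hκ : IsInversionKernel ρ κ)
    (hM : Measurable M) (hMmax : IsMaximalInvariant G M)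
    (hX : Measurable X) (hY : Measurable Y) (hγ : Measurable γ) (hγκ : IsSampledFrom P X Y γ κ)
    (h : IsEquivariantCondDistrib G P X Y) :
    (fun ω => (γ ω, X ω)) ⟂ᵢ[M ∘ X, hM.comp hX; P] (fun ω => (γ ω)⁻¹ • Y ω) := by
  obtain ⟨Q, hQm, hQ, hQe⟩ := h
  have := hκ.isMarkov
  obtain ⟨T, hT⟩ := hκ.exists_kernel_eq_orbitSelector Q
  have hTm : IsMarkovKernel T := ⟨fun x => by rw [hT]; infer_instance⟩
  have hTinv (x x' : 𝕏) (hx : M x = M x') : T x = T x' := by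
    obtain ⟨g, rfl⟩ := (hMmax x x').1 hx
    rw [hT, hT, hρ.invariant]
  have hX' : Measurable fun ω => (X ω, γ ω) := hX.prodMk hγ
  have hW : Measurable fun ω => (γ ω)⁻¹ • Y ω := hγ.inv.smul hY
  have hm : Measurable fun p : 𝕏 × G => p.2⁻¹ • p.1 := measurable_snd.inv.smul measurable_fst
  have hf : Measurable fun p : (𝕏 × G) × 𝕐 => p.1.2⁻¹ • p.2 :=
    (measurable_snd.comp measurable_fst).inv.smul measurable_snd
  -- `γ` carries no information on `Y` beyond that of `X`, so `γ⁻¹ Y` has law `γ⁻¹ Q(x) = Q(γ⁻¹ x)`.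
  have h1 : HasCondDistrib (fun ω => (γ ω)⁻¹ • Y ω) (fun ω => (X ω, γ ω)) (Q.comap _ hm) P :=
    hasCondDistrib_apply_prodMk (hasCondDistrib_prodMkRight_symm hQ hγκ) hf
      fun z => (hQe.map_smul z.2⁻¹ z.1).symm
  have hlaw : HasCondDistrib γ X κ P := HasCondDistrib.comp_right (hf := measurable_fst) hγκ
  -- Almost surely `γ⁻¹ X = ρ X`. The kernels are compared one measurable set at a time, so that
  -- the event on which they agree is visibly measurable.
  have h2 : HasCondDistrib (fun ω => (γ ω)⁻¹ • Y ω) (fun ω => (X ω, γ ω))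
      (Kernel.prodMkRight G T) P := by
    refine ⟨by fun_prop, h1.map_eq.trans (Measure.ext_prod fun {A B} hA hB => ?_)⟩
    rw [Measure.compProd_apply_prod hA hB, Measure.compProd_apply_prod hA hB]
    refine lintegral_congr_ae (ae_restrict_of_ae ?_)
    rw [hlaw.map_eq]
    refine Measure.ae_compProd_of_ae_ae (measurableSet_eq_fun (Kernel.measurable_coe _ hB)
      (Kernel.measurable_coe _ hB)) (Filter.Eventually.of_forall fun x => ?_)
    filter_upwards [hκ.smul_eq x] with g hg
    rw [Kernel.comap_apply, Kernel.prodMkRight_apply, hT, ← eq_inv_smul_iff.2 hg]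
  have h3 := condIndepFun_of_hasCondDistrib hX' hW h2 (hM.comp measurable_fst) fun B hB => by
    rw [← MeasurableSpace.comap_comp]
    exact (measurable_comap_of_forall_eq hM (Kernel.measurable_coe T hB)
      fun x x' hx => by rw [hTinv x x' hx]).comp (comap_measurable Prod.fst)
  exact h3.comp measurable_swap measurable_id

/-- Given `X = x`, the variable `Y = γ (γ⁻¹ Y)` has the law of `γ w`, with `γ` drawn from `κ x` and
`w` independently from the conditional law of `γ⁻¹ Y` given `M(X) = M(x)`. -/
lemma isEquivariantCondDistrib_of_condIndepFun [MeasurableMul G] (hκ : IsInversionKernel ρ κ)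
    (hM : Measurable M) (hMmax : IsMaximalInvariant G M)
    (hX : Measurable X) (hY : Measurable Y) (hγ : Measurable γ) (hγκ : IsSampledFrom P X Y γ κ)
    (h : (fun ω => (γ ω, X ω)) ⟂ᵢ[M ∘ X, hM.comp hX; P] (fun ω => (γ ω)⁻¹ • Y ω)) :
    IsEquivariantCondDistrib G P X Y := by
  have := hκ.isMarkov
  obtain ⟨ω₀⟩ := nonempty_of_isProbabilityMeasure P
  have : Nonempty 𝕐 := ⟨Y ω₀⟩
  have hX' : Measurable fun ω => (X ω, γ ω) := hX.prodMk hγ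
  have hW : Measurable fun ω => (γ ω)⁻¹ • Y ω := hγ.inv.smul hY
  have hs : Measurable fun p : G × 𝕐 => p.1 • p.2 := by fun_prop
  have h1 := hasCondDistrib_of_condIndepFun hX' hW (hM.comp measurable_fst)
    (h.comp measurable_swap measurable_id)
  set R : Kernel 𝕏 𝕐 := (condDistrib (fun ω => (γ ω)⁻¹ • Y ω) (M ∘ X) P).comap M hM
  have hlaw : HasCondDistrib γ X κ P := HasCondDistrib.comp_right (hf := measurable_fst) hγκ
  refine ⟨(κ ⊗ₖ Kernel.prodMkRight G R).map fun p => p.1 • p.2, Kernel.IsMarkovKernel.map _ hs,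
    ?_, hκ.equivariant.map_smul_compProd fun g x => ?_⟩
  · convert (hasCondDistrib_prodMk (η := Kernel.prodMkRight G R) hlaw h1).comp_left hs using 1
    ext ω
    simp
  · simp only [R, Kernel.comap_apply, (hMmax x (g • x)).2 ⟨g, rfl⟩]

end EquivariantCondDistrib

end CondSymmetry

theorem mainTheorem1
    {G : Type*} [Group G] [TopologicalSpace G] [IsTopologicalGroup G] [LocallyCompactSpace G]
    [SecondCountableTopology G] [T2Space G] [MeasurableSpace G] [BorelSpace G]
    {𝕏 : Type*} [TopologicalSpace 𝕏] [MeasurableSpace 𝕏] [BorelSpace 𝕏] [StandardBorelSpace 𝕏]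
    [MulAction G 𝕏] [ContinuousSMul G 𝕏]
    {𝕐 : Type*} [TopologicalSpace 𝕐] [MeasurableSpace 𝕐] [BorelSpace 𝕐] [StandardBorelSpace 𝕐]
    [MulAction G 𝕐] [ContinuousSMul G 𝕐]
    {𝕄 : Type*} [MeasurableSpace 𝕄] [StandardBorelSpace 𝕄]
    (hproper : CondSymmetry.IsProperAction G 𝕏)
    (ρ : 𝕏 → 𝕏) (hρ : CondSymmetry.IsOrbitSelector G ρ)
    (κ : Kernel 𝕏 G) (hκ : CondSymmetry.IsInversionKernel ρ κ)
    (M : 𝕏 → 𝕄) (hM : Measurable M) (hMmax : CondSymmetry.IsMaximalInvariant G M)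
    {Ω : Type*} [MeasurableSpace Ω] [StandardBorelSpace Ω] (P : Measure Ω) [IsProbabilityMeasure P]
    (X : Ω → 𝕏) (hX : Measurable X) (Y : Ω → 𝕐) (hY : Measurable Y)
    (γ : Ω → G) (hγ : Measurable γ) (hγκ : CondSymmetry.IsSampledFrom P X Y γ κ) :
    (CondSymmetry.IsEquivariantCondDistrib G P X Y ↔
      (fun ω => (γ ω, X ω)) ⟂ᵢ[M ∘ X, hM.comp hX; P] (fun ω => (γ ω)⁻¹ • Y ω)) ∧
    (∀ τ : 𝕏 → G, Measurable τ → CondSymmetry.IsRepresentativeInversion ρ τ →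
      (CondSymmetry.IsEquivariantCondDistrib G P X Y ↔
        X ⟂ᵢ[M ∘ X, hM.comp hX; P] (fun ω => (τ (X ω))⁻¹ • Y ω))) ∧
    ((∀ (g : G) (y : 𝕐), g • y = y) →
      (CondSymmetry.IsEquivariantCondDistrib G P X Y ↔
        X ⟂ᵢ[M ∘ X, hM.comp hX; P] Y)) := by
  open CondSymmetry in
  have main {κ' : Kernel 𝕏 G} (hκ' : IsInversionKernel ρ κ') {γ' : Ω → G} (hγ' : Measurable γ')
      (hγκ' : IsSampledFrom P X Y γ' κ') :
      IsEquivariantCondDistrib G P X Y ↔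
        (fun ω => (γ' ω, X ω)) ⟂ᵢ[M ∘ X, hM.comp hX; P] (fun ω => (γ' ω)⁻¹ • Y ω) :=
    ⟨fun h => h.condIndepFun hρ hκ' hM hMmax hX hY hγ' hγκ',
      isEquivariantCondDistrib_of_condIndepFun hκ' hM hMmax hX hY hγ' hγκ'⟩
  refine ⟨main hκ hγ hγκ, fun τ hτ hτρ => ?_, fun htriv => ⟨fun h => ?_, fun h => ?_⟩⟩
  -- The equivalence for an inversion kernel is used with the point masses at `τ x`.
  · rw [main (hτρ.isInversionKernel hτ) (hτ.comp hX)
      (CondSymmetry.isSampledFrom_deterministic hτ hX hY)]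
    exact ⟨fun h => h.comp measurable_snd measurable_id,
      fun h => h.comp (hτ.prodMk measurable_id) measurable_id⟩
  · have h' := ((main hκ hγ hγκ).1 h).comp measurable_snd measurable_id
    simpa only [htriv, Function.comp_def, id] using h'
  · obtain ⟨ω₀⟩ := nonempty_of_isProbabilityMeasure P
    have : Nonempty 𝕐 := ⟨Y ω₀⟩
    refine ⟨_, inferInstance, CondSymmetry.hasCondDistrib_of_condIndepFun hX hY hM h,
      fun g x B _ => ?_⟩
    have hB : g • B = B := by
      ext y
      simp [Set.mem_smul_set, htriv]
    rw [hB, Kernel.comap_apply, Kernel.comap_apply, ← (hMmax x (g • x)).2 ⟨g, rfl⟩]
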